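/- Let $\mathcal S,\mathcal X,\hat{\mathcal S},\hat{\mathcal X}$ be finite alphabets, $p$ a probability mass function on $\mathcal S\times\mathcal X$, and $d_s:\mathcal S\times\hat{\mathcal S}\to[0,\infty)$, $d_a:\mathcal X\times\hat{\mathcal X}\to[0,\infty)$ distortion functions. Let $(S_i,X_i)_{i\ge1}$ be i.i.d. with law $p$, and write $(S,X)$ for a generic pair. A code of block length $n$ and rate $R\in\mathbb R$ consists of an encoder $f_n:\mathcal X^n\to\{1,\dots,\lfloor 2^{nR}\rfloor\}$ and a decoder $g_n:\{1,\dots,\lfloor 2^{nR}\rfloor\}\to\hat{\mathcal S}^n\times\hat{\mathcal X}^n$; put $(\hat S^n,\hat X^n)=g_n(f_n(X^n))$, so that only $X^n$ is encoded. The triple $(R,D_s,D_a)\in\mathbb R^3$ is achievable if there are codes $(f_n,g_n)$ of rate $R$, one for every $n$, such that the limits below exist and $$\lim_{n\to\infty}\mathbf E\,\frac1n\sum_{i=1}^n d_s(S_i,\hat S_i)\le D_s,\qquad \lim_{n\to\infty}\mathbf E\,\frac1n\sum_{i=1}^n d_a(X_i,\hat X_i)\le D_a .$$ The state-observation rate-distortion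 function is $R(D_s,D_a)=\inf\{R:(R,D_s,D_a)\text{ is achievable}\}$, with $\inf\emptyset=+\infty$. Theorem. For all $D_s,D_a\in\mathbb R$, $$R(D_s,D_a)=\min I(X;\hat S,\hat X)\quad\text{subject to}\quad \mathbf E\,\hat d_s(X,\hat S)\le D_s,\quad \mathbf E\,d_a(X,\hat X)\le D_a,$$ where the minimum is over all conditional probability mass functions $p(\hat s,\hat x\mid x)$, the mutual information is in bits and computed under $p(x)\,p(\hat s,\hat x\mid x)$, and $$\hat d_s(x,\hat s)=\frac1{p(x)}\sum_{s\in\mathcal S}p(s,x)\,d_s(s,\hat s).$$ The minimum is attained whenever the constraints can be met, and is read as $+\infty$ otherwise. More explicitly, (achievability) if a conditional law meets the two constraints, then $(R,D_s,D_a)$ is achievable for every $R>I(X;\hat S,\hat X)$; (converse) if $(R,D_s,D_a)$ is achievable, then some conditional law meets the two constraints with $I(X;\hat S,\hat X)\le R$. -/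

import Mathlib

open Filter Topology

namespace SORDF

noncomputable section

variable {S X Sh Xh : Type*} [Fintype S] [Fintype X] [Fintype Sh] [Fintype Xh]

/-- A block code of length `n` with `M` messages: the encoder sees the observation block only,
the decoder outputs a block of state reproductions and a block of observation reproductions. -/
structure Code (X Sh Xh : Type*) (n M : ℕ) where
  /-- the encoder -/
  enc : (Fin n → X) → Fin M
  /-- the decoder -/
  dec : Fin M → (Fin n → Sh) × (Fin n → Xh)

/-- Block-wise distortion: the average of the single-letter distortions. -/
def blockDist {A B : Type*} (d : A → B → ℝ) {n : ℕ} (a : Fin n → A) (b : Fin n → B) : ℝ :=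
  (1 / (n : ℝ)) * ∑ i, d (a i) (b i)

/-- Probability of a block of source pairs, the pairs being i.i.d. with law `p`. -/
def blockProb (p : S × X → ℝ) {n : ℕ} (z : Fin n → S × X) : ℝ := ∏ i, p (z i)

/-- Expected block-wise semantic distortion of a code. -/
def Code.expDistS (p : S × X → ℝ) (ds : S → Sh → ℝ) {n M : ℕ} (c : Code X Sh Xh n M) : ℝ :=
  ∑ z : Fin n → S × X, blockProb p z *
    blockDist ds (fun i => (z i).1) (c.dec (c.enc fun i => (z i).2)).1

/-- Expected block-wise appearance distortion of a code. -/
def Code.expDistA (p : S × X → ℝ) (da : X → Xh → ℝ) {n M : ℕ} (c : Code X Sh Xh n M) : ℝ :=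
  ∑ z : Fin n → S × X, blockProb p z *
    blockDist da (fun i => (z i).2) (c.dec (c.enc fun i => (z i).2)).2

/-- The triple `(R, Ds, Da)` is achievable: there is a sequence of codes, with `⌊2 ^ (n R)⌋`
messages at block length `n`, whose expected distortions have limits at most `Ds` and `Da`. -/
def Achievable (p : S × X → ℝ) (ds : S → Sh → ℝ) (da : X → Xh → ℝ) (R Ds Da : ℝ) : Prop :=
  ∃ c : ∀ n : ℕ, Code X Sh Xh n ⌊(2 : ℝ) ^ ((n : ℝ) * R)⌋₊,
    (∃ L ≤ Ds, Tendsto (fun n => (c n).expDistS p ds) atTop (𝓝 L)) ∧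
    (∃ L ≤ Da, Tendsto (fun n => (c n).expDistA p da) atTop (𝓝 L))

/-- The state-observation rate-distortion function: the lower boundary, in the rate coordinate,
of the set of achievable triples (`⊤` if no rate is achievable). -/
def sordf (p : S × X → ℝ) (ds : S → Sh → ℝ) (da : X → Xh → ℝ) (Ds Da : ℝ) : EReal :=
  ⨅ (R : ℝ) (_ : Achievable p ds da R Ds Da), (R : EReal)

/-- The marginal law of the observation. -/
def margX (p : S × X → ℝ) (x : X) : ℝ := ∑ s, p (s, x)

/-- The surrogate semantic distortion
`(1 / p(x)) ∑ s, p(s, x) ds(s, sh)` (only its values at `p(x) > 0` matter). -/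
def dHat (p : S × X → ℝ) (ds : S → Sh → ℝ) (x : X) (sh : Sh) : ℝ :=
  (1 / margX p x) * ∑ s, p (s, x) * ds s sh

/-- Joint law of the observation and the output of the channel `W` fed with it. -/
def jointLaw {Y : Type*} (p : S × X → ℝ) (W : X → Y → ℝ) (x : X) (y : Y) : ℝ :=
  margX p x * W x y

/-- Mutual information in bits between the two coordinates of a joint probability mass
function `q`. A term with `q x y = 0` is zero, as it should be. -/
def mutualInfo {A B : Type*} [Fintype A] [Fintype B] (q : A → B → ℝ) : ℝ :=
  ∑ a, ∑ b, q a b * Real.logb 2 (q a b / ((∑ b', q a b') * ∑ a', q a' b))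

/-- The conditional laws of the reproduction pair given the observation that meet both
single-letter distortion constraints. -/
def feasible (p : S × X → ℝ) (ds : S → Sh → ℝ) (da : X → Xh → ℝ) (Ds Da : ℝ) :
    Set (X → Sh × Xh → ℝ) :=
  {W | (∀ x, W x ∈ stdSimplex ℝ (Sh × Xh)) ∧
    ∑ x, ∑ y, jointLaw p W x y * dHat p ds x y.1 ≤ Ds ∧
    ∑ x, ∑ y, jointLaw p W x y * da x y.2 ≤ Da}

end

end SORDF

/-!
The encoder never sees the states, and given the observations the states are independent, so the
expected state distortion of a code equals its expected surrogate distortion `dHat` between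
observations and state reproductions (`Code.expDistS_eq`). What remains is a rate-distortion problem
for the source `X` with reproduction alphabet `Sh × Xh` and two distortion measures.

Achievability. By the weak law, pairs of blocks drawn through the channel `W` have, with high
probability, distortions close to their means and information density at most `n (I + δ)`. On such
pairs the block channel is at most `2 ^ (n (I + δ))` times the product output law, so a random
codebook with `2 ^ (n R)` words, `R > I + δ`, contains a good word for almost every source block
(`exists_codebook`). The distortions are controlled from both sides, so the expected distortions
of a sequence of best codes converge to those of `W`, and the limits that `Achievable` asks for
exist (`achievable_of_mutualInfo_lt`).

Converse. For a code of length `n` with `M` messages let `q` be the joint law of the pair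
`(X_i, Y_i)` at a uniformly random time, and `V` its backward channel. Then `n I(q)` is the
expectation of `log ∏ V(X_i | Y_i) / P(X_i)`, which by Jensen is at most the logarithm of
`∑_x ∏ V(x_i | y_i(x)) ≤ ∑_m ∑_x ∏ V(x_i | y_i(m)) ≤ M` (`mutualInfo_timeAvgLaw_le`). This replaces
both the chain rule and the convexity of mutual information. The distortions of `q` are exactly
those of the code, and a limit point of the channels obtained along a sequence of codes meets the
constraints with information at most `R`, since the set of channels is compact and mutual
information is continuous on it. The same compactness shows that the minimum is attained.
-/

open Filter Topology

namespace SORDF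

/-! ### Sums over blocks -/

section Blocks

variable {A B : Type*} [Fintype A] [Fintype B]

theorem sum_block_prod {n : ℕ} (w : Fin n → A → ℝ) :
    ∑ z : Fin n → A, ∏ i, w i (z i) = ∏ i, ∑ a, w i a := by
  classical
  rw [Finset.prod_univ_sum, Fintype.piFinset_univ]

theorem sum_block_iid {n : ℕ} {P : A → ℝ} (hP : ∑ a, P a = 1) :
    ∑ z : Fin n → A, ∏ i, P (z i) = 1 := by
  simp [sum_block_prod (fun _ : Fin n => P), hP]

theorem sum_block_prod_mul {n : ℕ} (w : Fin n → A → ℝ) (j : Fin n) (h : A → ℝ) :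
    ∑ z : Fin n → A, (∏ i, w i (z i)) * h (z j) =
      (∏ i ∈ Finset.univ.erase j, ∑ a, w i a) * ∑ a, w j a * h a := by
  classical
  have key := sum_block_prod (fun i a => if i = j then w i a * h a else w i a)
  rw [← Finset.prod_erase_mul _ _ (Finset.mem_univ j)] at key
  have e : ∏ i ∈ Finset.univ.erase j, ∑ a, (if i = j then w i a * h a else w i a) =
      ∏ i ∈ Finset.univ.erase j, ∑ a, w i a :=
    Finset.prod_congr rfl fun i hi => by simp [Finset.ne_of_mem_erase hi]
  rw [e] at key
  simp only [if_true] at key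
  rw [← key]
  refine Finset.sum_congr rfl fun z _ => ?_
  rw [← Finset.prod_erase_mul _ _ (Finset.mem_univ j),
    ← Finset.prod_erase_mul _ (fun i => if i = j then _ else _) (Finset.mem_univ j)]
  have e' : ∏ i ∈ Finset.univ.erase j, (if i = j then w i (z i) * h (z i) else w i (z i)) =
      ∏ i ∈ Finset.univ.erase j, w i (z i) :=
    Finset.prod_congr rfl fun i hi => by simp [Finset.ne_of_mem_erase hi]
  rw [e']
  simp [mul_assoc]

theorem sum_block_iid_mul {n : ℕ} {P : A → ℝ} (hP : ∑ a, P a = 1) (j : Fin n) (h : A → ℝ) :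
    ∑ z : Fin n → A, (∏ i, P (z i)) * h (z j) = ∑ a, P a * h a := by
  simp [sum_block_prod_mul (fun _ => P), hP]

/-- A block of pairs is a pair of blocks. -/
theorem sum_block_pair {n : ℕ} (F : (Fin n → A) → (Fin n → B) → ℝ) :
    ∑ z : Fin n → A × B, F (fun i => (z i).1) (fun i => (z i).2) = ∑ a, ∑ b, F a b := by
  rw [← Fintype.sum_prod_type',
    ← (Equiv.arrowProdEquivProdArrow (Fin n) (fun _ => A) (fun _ => B)).sum_comp]
  rfl

theorem sum_block_succ {n : ℕ} (F : (Fin (n + 1) → A) → ℝ) :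
    ∑ z, F z = ∑ a, ∑ z : Fin n → A, F (Fin.cons a z) := by
  rw [← Fintype.sum_prod_type', ← (Fin.consEquiv (fun _ => A)).sum_comp]
  rfl

end Blocks

/-! ### The weak law of large numbers on a finite alphabet -/

section WeakLaw

variable {A : Type*} [Fintype A]

/-- Variances of independent centred summands add up. -/
theorem sum_block_sq {P h : A → ℝ} (hP : ∑ a, P a = 1) (hh : ∑ a, P a * h a = 0) (n : ℕ) :
    ∑ z : Fin n → A, (∏ i, P (z i)) * (∑ i, h (z i)) ^ 2 = n * ∑ a, P a * h a ^ 2 := by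
  induction n with
  | zero => simp
  | succ n ih =>
    rw [sum_block_succ]
    simp only [Fin.prod_univ_succ, Fin.sum_univ_succ, Fin.cons_zero, Fin.cons_succ]
    have e : ∀ (a : A) (z : Fin n → A),
        P a * (∏ i, P (z i)) * (h a + ∑ i, h (z i)) ^ 2 =
          P a * h a ^ 2 * (∏ i, P (z i)) + 2 * (P a * h a) * ((∏ i, P (z i)) * ∑ i, h (z i)) +
            P a * ((∏ i, P (z i)) * (∑ i, h (z i)) ^ 2) := fun a z => by ring
    simp only [e, Finset.sum_add_distrib, ← Finset.mul_sum, ← Finset.sum_mul, ih, hh, hP,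
      sum_block_iid hP]
    push_cast
    ring

open Classical in
/-- The weak law of large numbers, by Chebyshev's inequality. -/
theorem tendsto_block_deviation {P : A → ℝ} (hP0 : ∀ a, 0 ≤ P a) (hP : ∑ a, P a = 1)
    (h : A → ℝ) {ε : ℝ} (hε : 0 < ε) :
    Tendsto (fun n : ℕ => ∑ z : Fin n → A, (∏ i, P (z i)) *
      (if ε ≤ |1 / (n : ℝ) * ∑ i, h (z i) - ∑ a, P a * h a| then 1 else 0)) atTop (𝓝 0) := by
  set μ := ∑ a, P a * h a with hμ
  set V := ∑ a, P a * (h a - μ) ^ 2 with hV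
  have hc : ∑ a, P a * (h a - μ) = 0 := by
    simp [mul_sub, Finset.sum_sub_distrib, ← Finset.sum_mul, hP, ← hμ]
  have hlim : Tendsto (fun n : ℕ => (V / ε ^ 2) / (n : ℝ)) atTop (𝓝 0) :=
    tendsto_const_div_atTop_nhds_zero_nat _
  refine tendsto_of_tendsto_of_tendsto_of_le_of_le' tendsto_const_nhds hlim
    (Eventually.of_forall fun n => Finset.sum_nonneg fun z _ =>
      mul_nonneg (Finset.prod_nonneg fun i _ => hP0 _) (by split_ifs <;> norm_num)) ?_
  filter_upwards [eventually_gt_atTop 0] with n hn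
  have hn' : (0 : ℝ) < n := by exact_mod_cast hn
  have hsq := sum_block_sq (h := fun a => h a - μ) hP hc n
  have e : V / ε ^ 2 / n = ∑ z : Fin n → A,
      (∏ i, P (z i)) * ((∑ i, (h (z i) - μ)) ^ 2 / (n * ε) ^ 2) := by
    simp only [← mul_div_assoc, ← Finset.sum_div, hsq, ← hV]
    field_simp
  rw [e]
  refine Finset.sum_le_sum fun z _ =>
    mul_le_mul_of_nonneg_left ?_ (Finset.prod_nonneg fun i _ => hP0 _)
  split_ifs with hz
  · have e2 : ∑ i, (h (z i) - μ) = n * (1 / (n : ℝ) * ∑ i, h (z i) - μ) := by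
      simp [Finset.sum_sub_distrib]
      field_simp
    rw [e2, mul_pow, mul_pow, one_le_div (by positivity), ← sq_abs (1 / (n : ℝ) * _ - μ)]
    gcongr
  · positivity

end WeakLaw

/-! ### Covering by a random codebook -/

section Covering

variable {A B : Type*} [Fintype A] [Fintype B]

/-- Some value is at most the mean. -/
theorem exists_le_of_weighted_sum_le {ι : Type*} [Fintype ι] {w v : ι → ℝ} {r : ℝ}
    (hw : ∀ i, 0 ≤ w i) (hw1 : ∑ i, w i = 1) (h : ∑ i, w i * v i ≤ r) : ∃ i, v i ≤ r := by
  by_contra! hcon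
  obtain ⟨i, -, hi⟩ : ∃ i ∈ Finset.univ, 0 < w i :=
    Finset.exists_lt_of_sum_lt (f := fun _ => 0) (by simp [hw1])
  have : ∑ i, w i * r < ∑ i, w i * v i :=
    Finset.sum_lt_sum (fun j _ => mul_le_mul_of_nonneg_left (hcon j).le (hw j))
      ⟨i, Finset.mem_univ i, mul_lt_mul_of_pos_left (hcon i) hi⟩
  rw [← Finset.sum_mul, hw1] at this
  linarith

/-- The probability `(1 - u) ^ M` that `M` independent words all miss, where one word hits with
probability `u ≥ s c`. The exponential `exp (-s M c)` is bounded by its chord over `s ∈ [0, 1]`. -/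
theorem one_sub_pow_le {s c u : ℝ} {M : ℕ} (hs0 : 0 ≤ s) (hs1 : s ≤ 1) (hu : u ≤ 1)
    (hcu : s * c ≤ u) : (1 - u) ^ M ≤ 1 - s + Real.exp (-(M * c)) := by
  have h1 : (1 - u) ^ M ≤ Real.exp (-u) ^ M :=
    pow_le_pow_left₀ (by linarith) (Real.one_sub_le_exp_neg u) M
  have h2 : Real.exp (-u) ^ M ≤ Real.exp (s * (-(M * c))) := by
    rw [← Real.exp_nat_mul]
    refine Real.exp_le_exp.2 ?_
    have := mul_le_mul_of_nonneg_left hcu (Nat.cast_nonneg (α := ℝ) M)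
    nlinarith
  have h3 := convexOn_exp.2 (Set.mem_univ 0) (Set.mem_univ (-(M * c))) (sub_nonneg.2 hs1) hs0
    (by ring)
  simp only [smul_eq_mul, mul_zero, zero_add, Real.exp_zero, mul_one] at h3
  have h4 : s * Real.exp (-(M * c)) ≤ Real.exp (-(M * c)) :=
    mul_le_of_le_one_left (Real.exp_pos _).le hs1
  linarith

open Classical in
/-- One-shot covering. If the channel `K` is dominated by `t • Q` on the relation `G`, then some
codebook of `M` words covers the source up to the probability that `G` fails under `P` and `K`,
plus `exp (-M / t)`. The codebook is found by averaging over independent words of law `Q`. -/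
theorem exists_codebook {P : A → ℝ} (hP0 : ∀ a, 0 ≤ P a) (hP : ∑ a, P a = 1)
    {Q : B → ℝ} (hQ0 : ∀ b, 0 ≤ Q b) (hQ : ∑ b, Q b = 1)
    {K : A → B → ℝ} (hK0 : ∀ a b, 0 ≤ K a b) (hK : ∀ a, ∑ b, K a b = 1)
    (G : A → B → Prop) {t : ℝ} (ht : 0 < t) (hG : ∀ a b, G a b → K a b ≤ t * Q b) (M : ℕ) :
    ∃ C : Fin M → B, ∑ a, P a * (if ∃ m, G a (C m) then 0 else 1) ≤
      ∑ a, ∑ b, P a * K a b * (if G a b then 0 else 1) + Real.exp (-(M * t⁻¹)) := by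
  refine exists_le_of_weighted_sum_le (w := fun C : Fin M → B => ∏ m, Q (C m))
    (fun C => Finset.prod_nonneg fun m _ => hQ0 _) (sum_block_iid hQ) ?_
  have e1 : ∀ (a : A) (C : Fin M → B),
      (if ∃ m, G a (C m) then (0 : ℝ) else 1) = ∏ m, (if G a (C m) then 0 else 1) := by
    intro a C
    split_ifs with h
    · obtain ⟨m, hm⟩ := h
      exact (Finset.prod_eq_zero (Finset.mem_univ m) (by simp [hm])).symm
    · push Not at h
      exact (Finset.prod_eq_one fun m _ => by simp [h m]).symm
  have e2 : ∀ a, ∑ b, Q b * (if G a b then (0 : ℝ) else 1) =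
      1 - ∑ b, Q b * (if G a b then 1 else 0) := by
    intro a
    rw [eq_sub_iff_add_eq, ← Finset.sum_add_distrib]
    refine (Finset.sum_congr rfl fun b _ => ?_).trans hQ
    split_ifs <;> simp
  have e3 : ∀ a, ∑ b, K a b * (if G a b then (0 : ℝ) else 1) =
      1 - ∑ b, K a b * (if G a b then 1 else 0) := by
    intro a
    rw [eq_sub_iff_add_eq, ← Finset.sum_add_distrib]
    refine (Finset.sum_congr rfl fun b _ => ?_).trans (hK a)
    split_ifs <;> simp
  calc ∑ C : Fin M → B, (∏ m, Q (C m)) * ∑ a, P a * (if ∃ m, G a (C m) then (0 : ℝ) else 1)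
      = ∑ a, P a * ∑ C : Fin M → B, ∏ m, (Q (C m) * (if G a (C m) then (0 : ℝ) else 1)) := by
        simp only [Finset.mul_sum, e1, Finset.prod_mul_distrib]
        rw [Finset.sum_comm]
        refine Finset.sum_congr rfl fun a _ => Finset.sum_congr rfl fun C _ => by ring
    _ = ∑ a, P a * (1 - ∑ b, Q b * (if G a b then (1 : ℝ) else 0)) ^ M := by
        refine Finset.sum_congr rfl fun a _ => ?_
        rw [sum_block_prod (fun _ b => Q b * (if G a b then (0 : ℝ) else 1)), e2]
        simp
    _ ≤ ∑ a, P a * (1 - ∑ b, K a b * (if G a b then (1 : ℝ) else 0) +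
          Real.exp (-(M * t⁻¹))) := by
        refine Finset.sum_le_sum fun a _ => mul_le_mul_of_nonneg_left ?_ (hP0 a)
        refine one_sub_pow_le ?_ ?_ ?_ ?_
        · exact Finset.sum_nonneg fun b _ => mul_nonneg (hK0 a b) (by split_ifs <;> norm_num)
        · exact (Finset.sum_le_sum fun b _ =>
            mul_le_of_le_one_right (hK0 a b) (by split_ifs <;> norm_num)).trans_eq (hK a)
        · exact (Finset.sum_le_sum fun b _ =>
            mul_le_of_le_one_right (hQ0 b) (by split_ifs <;> norm_num)).trans_eq hQ
        · rw [Finset.sum_mul]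
          refine Finset.sum_le_sum fun b _ => ?_
          split_ifs with h
          · rw [mul_one, mul_one, ← div_eq_mul_inv, div_le_iff₀' ht]
            exact hG a b h
          · simp
    _ = ∑ a, ∑ b, P a * K a b * (if G a b then 0 else 1) + Real.exp (-(M * t⁻¹)) := by
        simp only [mul_assoc, ← Finset.mul_sum, e3, mul_add, Finset.sum_add_distrib,
          ← Finset.sum_mul, hP, one_mul]

end Covering

/-! ### Mutual information -/

section MutualInfo

variable {A B : Type*} [Fintype A] [Fintype B]

/-- Mutual information as a difference of entropies, in a form continuous in the joint law. -/
theorem mutualInfo_eq {q : A → B → ℝ} (hq : ∀ a b, 0 ≤ q a b) :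
    mutualInfo q = (∑ a, ∑ b, q a b * Real.log (q a b) -
      ∑ a, (∑ b, q a b) * Real.log (∑ b, q a b) -
      ∑ b, (∑ a, q a b) * Real.log (∑ a, q a b)) / Real.log 2 := by
  have e : ∀ a b, q a b * Real.logb 2 (q a b / ((∑ b', q a b') * ∑ a', q a' b)) =
      (q a b * Real.log (q a b) - q a b * Real.log (∑ b', q a b') -
        q a b * Real.log (∑ a', q a' b)) / Real.log 2 := by
    intro a b
    rcases (hq a b).eq_or_lt with h | h
    · simp [← h]
    · have h1 : 0 < ∑ b', q a b' :=
        h.trans_le (Finset.single_le_sum (fun b' _ => hq a b') (Finset.mem_univ b))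
      have h2 : 0 < ∑ a', q a' b :=
        h.trans_le (Finset.single_le_sum (f := fun a' => q a' b) (fun a' _ => hq a' b)
          (Finset.mem_univ a))
      rw [Real.logb, Real.log_div h.ne' (by positivity), Real.log_mul h1.ne' h2.ne']
      ring
  rw [mutualInfo, Finset.sum_congr rfl fun a _ => Finset.sum_congr rfl fun b _ => e a b]
  simp only [← Finset.sum_div, Finset.sum_sub_distrib, Finset.sum_mul]
  rw [Finset.sum_comm (f := fun b a => q a b * Real.log (∑ a', q a' b))]

theorem mutualInfo_nonneg {q : A → B → ℝ} (hq : ∀ a b, 0 ≤ q a b)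
    (hq1 : ∑ a, ∑ b, q a b = 1) : 0 ≤ mutualInfo q := by
  have h2 : 0 < Real.log 2 := Real.log_pos one_lt_two
  have key : ∀ a b, (q a b - (∑ b', q a b') * ∑ a', q a' b) / Real.log 2 ≤
      q a b * Real.logb 2 (q a b / ((∑ b', q a b') * ∑ a', q a' b)) := by
    intro a b
    have hA : 0 ≤ ∑ b', q a b' := Finset.sum_nonneg fun b' _ => hq a b'
    have hB : 0 ≤ ∑ a', q a' b := Finset.sum_nonneg fun a' _ => hq a' b
    rw [Real.logb, ← mul_div_assoc]
    refine div_le_div_of_nonneg_right ?_ h2.le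
    rcases (hq a b).eq_or_lt with h | h
    · rw [← h]
      simpa using mul_nonneg hA hB
    · have h1 : 0 < ∑ b', q a b' :=
        h.trans_le (Finset.single_le_sum (fun b' _ => hq a b') (Finset.mem_univ b))
      have h2 : 0 < ∑ a', q a' b :=
        h.trans_le (Finset.single_le_sum (f := fun a' => q a' b) (fun a' _ => hq a' b)
          (Finset.mem_univ a))
      have := Real.one_sub_inv_le_log_of_pos (div_pos h (mul_pos h1 h2))
      refine le_trans (le_of_eq ?_) (mul_le_mul_of_nonneg_left this h.le)
      field_simp
  refine le_trans (le_of_eq ?_) (Finset.sum_le_sum fun a _ => Finset.sum_le_sum fun b _ => key a b)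
  simp only [← Finset.sum_div, Finset.sum_sub_distrib, ← Finset.mul_sum, hq1]
  rw [Finset.sum_comm (f := fun b a => q a b), ← Finset.sum_mul, hq1]
  simp

end MutualInfo

/-! ### Achievability by block codes -/

section Achievability

variable {X Y : Type*} [Fintype X] [Fintype Y]

theorem abs_blockDist_le (d : X → Y → ℝ) {n : ℕ} (a : Fin n → X) (b : Fin n → Y) :
    |blockDist d a b| ≤ ∑ x, ∑ y, |d x y| := by
  have hB : 0 ≤ ∑ x, ∑ y, |d x y| := by positivity
  have h1 : ∀ x y, |d x y| ≤ ∑ x, ∑ y, |d x y| := fun x y =>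
    (Finset.single_le_sum (f := fun y => |d x y|) (fun _ _ => abs_nonneg _)
      (Finset.mem_univ y)).trans
    (Finset.single_le_sum (f := fun x => ∑ y, |d x y|)
      (fun _ _ => Finset.sum_nonneg fun _ _ => abs_nonneg _) (Finset.mem_univ x))
  have h2 : |∑ i, d (a i) (b i)| ≤ n * ∑ x, ∑ y, |d x y| := by
    refine (Finset.abs_sum_le_sum_abs _ _).trans
      ((Finset.sum_le_sum fun i _ => h1 (a i) (b i)).trans_eq ?_)
    simp
  rw [blockDist, abs_mul, abs_of_nonneg (by positivity)]
  rcases n.eq_zero_or_pos with rfl | hn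
  · simpa using hB
  · have hn' : (0 : ℝ) < n := by exact_mod_cast hn
    rw [one_div, inv_mul_le_iff₀ hn']
    exact h2

/-- The number of messages outgrows every exponential of smaller rate. -/
theorem tendsto_messages_div {R R' : ℝ} (h0 : 0 ≤ R') (h : R' < R) :
    Tendsto (fun n : ℕ => (⌊(2 : ℝ) ^ ((n : ℝ) * R)⌋₊ : ℝ) * ((2 : ℝ) ^ ((n : ℝ) * R'))⁻¹)
      atTop atTop := by
  have h1 : Tendsto (fun n : ℕ => ((2 : ℝ) ^ (R - R')) ^ n - 1) atTop atTop :=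
    tendsto_atTop_add_const_right _ _
      (tendsto_pow_atTop_atTop_of_one_lt (Real.one_lt_rpow one_lt_two (by linarith)))
  refine tendsto_atTop_mono (fun n => ?_) h1
  have hpos : (0 : ℝ) < 2 ^ ((n : ℝ) * R') := by positivity
  have hge : (1 : ℝ) ≤ 2 ^ ((n : ℝ) * R') := Real.one_le_rpow one_le_two (by positivity)
  have e : (2 : ℝ) ^ ((n : ℝ) * R) = ((2 : ℝ) ^ (R - R')) ^ n * 2 ^ ((n : ℝ) * R') := by
    rw [← Real.rpow_natCast, ← Real.rpow_mul zero_le_two, ← Real.rpow_add two_pos]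
    ring_nf
  rw [← div_eq_mul_inv, le_div_iff₀ hpos]
  have := Nat.sub_one_lt_floor ((2 : ℝ) ^ ((n : ℝ) * R))
  nlinarith

/-- If the empirical information density of a pair of blocks is below `I + δ`, then the block
channel is dominated by `2 ^ (n (I + δ))` times the product output law at this pair. -/
theorem prod_channel_le {P : X → ℝ} {W : X → Y → ℝ} (hP0 : ∀ x, 0 ≤ P x)
    (hW : ∀ x, W x ∈ stdSimplex ℝ Y) {n : ℕ} (hn : 0 < n) (z : Fin n → X × Y)
    (hz : ∀ i, 0 < P (z i).1 * W (z i).1 (z i).2) {c : ℝ}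
    (hc : 1 / (n : ℝ) * ∑ i, Real.logb 2 (P (z i).1 * W (z i).1 (z i).2 /
      ((∑ y, P (z i).1 * W (z i).1 y) * ∑ x, P x * W x (z i).2)) ≤ c) :
    ∏ i, W (z i).1 (z i).2 ≤ 2 ^ ((n : ℝ) * c) * ∏ i, ∑ x, P x * W x (z i).2 := by
  have hn' : (0 : ℝ) < n := by exact_mod_cast hn
  have h1 : ∀ i, W (z i).1 (z i).2 =
      2 ^ Real.logb 2 (P (z i).1 * W (z i).1 (z i).2 /
        ((∑ y, P (z i).1 * W (z i).1 y) * ∑ x, P x * W x (z i).2)) *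
          ∑ x, P x * W x (z i).2 := by
    intro i
    have hP : 0 < P (z i).1 := (hP0 _).lt_of_ne fun h => by simpa [← h] using hz i
    have hr : 0 < ∑ x, P x * W x (z i).2 :=
      (hz i).trans_le (Finset.single_le_sum (f := fun x => P x * W x (z i).2)
        (fun x _ => mul_nonneg (hP0 x) ((hW x).1 _)) (Finset.mem_univ _))
    rw [← Finset.mul_sum, (hW _).2, mul_one,
      Real.rpow_logb two_pos (by norm_num) (div_pos (hz i) (mul_pos hP hr))]
    field_simp
  rw [Finset.prod_congr rfl fun i _ => h1 i, Finset.prod_mul_distrib,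
    ← Real.rpow_sum_of_pos two_pos]
  refine mul_le_mul_of_nonneg_right (Real.rpow_le_rpow_of_exponent_le one_le_two ?_)
    (Finset.prod_nonneg fun i _ => Finset.sum_nonneg fun x _ => mul_nonneg (hP0 x) ((hW x).1 _))
  rwa [one_div, inv_mul_le_iff₀ hn'] at hc

open Classical in
/-- Achievability: above the mutual information there are, at all large lengths, codes whose
distortions, for finitely many distortion measures at once, are within `ε` of those of the
single-letter channel. A pair of blocks is good if the channel is dominated as in
`prod_channel_le` and all distortions are typical; the covering lemma supplies the codebook. -/
theorem eventually_exists_block_code {κ : Type*} [Fintype κ] {P : X → ℝ}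
    (hP0 : ∀ x, 0 ≤ P x) (hP : ∑ x, P x = 1) {W : X → Y → ℝ} (hW : ∀ x, W x ∈ stdSimplex ℝ Y)
    (d : κ → X → Y → ℝ) {R : ℝ} (hR : mutualInfo (fun x y => P x * W x y) < R)
    {ε : ℝ} (hε : 0 < ε) :
    ∀ᶠ n : ℕ in atTop, ∃ (enc : (Fin n → X) → Fin ⌊(2 : ℝ) ^ ((n : ℝ) * R)⌋₊)
      (dec : Fin ⌊(2 : ℝ) ^ ((n : ℝ) * R)⌋₊ → Fin n → Y), ∀ k,
      |∑ x : Fin n → X, (∏ i, P (x i)) * blockDist (d k) x (dec (enc x)) -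
        ∑ x, ∑ y, P x * W x y * d k x y| ≤ ε := by
  set I := mutualInfo (fun x y => P x * W x y) with hI
  have hq0 : ∀ x y, 0 ≤ P x * W x y := fun x y => mul_nonneg (hP0 x) ((hW x).1 y)
  have hq1 : ∑ x, ∑ y, P x * W x y = 1 := by simp [← Finset.mul_sum, (hW _).2, hP]
  have hI0 : 0 ≤ I := mutualInfo_nonneg hq0 hq1
  set δ := (R - I) / 2 with hδ
  have hδ0 : 0 < δ := by linarith
  set D : κ → ℝ := fun k => ∑ x, ∑ y, P x * W x y * d k x y with hD
  set ι : X × Y → ℝ := fun z => Real.logb 2 (P z.1 * W z.1 z.2 /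
      ((∑ y, P z.1 * W z.1 y) * ∑ x, P x * W x z.2)) with hι
  set q : X × Y → ℝ := fun z => P z.1 * W z.1 z.2 with hq
  have hqs : ∑ z, q z = 1 := by rw [Fintype.sum_prod_type]; exact hq1
  have hqι : ∑ z, q z * ι z = I := by rw [Fintype.sum_prod_type]; rfl
  have hqd : ∀ k, ∑ z, q z * d k z.1 z.2 = D k := fun k => by rw [Fintype.sum_prod_type]
  -- the probability of atypical pairs of blocks
  set T : ℕ → ℝ := fun n =>
    ∑ z : Fin n → X × Y, (∏ i, q (z i)) *
      (if δ ≤ |1 / (n : ℝ) * ∑ i, ι (z i) - I| then 1 else 0) +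
    ∑ k, ∑ z : Fin n → X × Y, (∏ i, q (z i)) *
      (if ε / 2 ≤ |1 / (n : ℝ) * ∑ i, d k (z i).1 (z i).2 - D k| then 1 else 0) with hT
  have hTlim : Tendsto T atTop (𝓝 0) := by
    have h1 := tendsto_block_deviation (P := q) (fun z => hq0 _ _) hqs ι hδ0
    have h2 := fun k => tendsto_block_deviation (P := q) (fun z => hq0 _ _) hqs
      (fun z => d k z.1 z.2) (half_pos hε)
    simp only [hqι] at h1
    simp only [hqd] at h2
    simpa only [Finset.sum_const_zero, add_zero] using
      h1.add (tendsto_finsetSum Finset.univ fun k _ => h2 k)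
  have hM := tendsto_messages_div (R := R) (R' := I + δ) (by positivity) (by linarith)
  set Bd := ∑ k, (∑ x, ∑ y, |d k x y| + |D k|) with hBd
  have hBd0 : 0 ≤ Bd := by positivity
  have hlim : Tendsto (fun n : ℕ => Bd * (T n + Real.exp
      (-((⌊(2 : ℝ) ^ ((n : ℝ) * R)⌋₊ : ℝ) * ((2 : ℝ) ^ ((n : ℝ) * (I + δ)))⁻¹)))) atTop (𝓝 0) := by
    simpa using (hTlim.add (Real.tendsto_exp_neg_atTop_nhds_zero.comp hM)).const_mul Bd
  filter_upwards [eventually_gt_atTop 0, hlim.eventually (ge_mem_nhds (half_pos hε))]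
    with n hn hsmall
  have hn' : (0 : ℝ) < n := by exact_mod_cast hn
  have hMpos : 0 < ⌊(2 : ℝ) ^ ((n : ℝ) * R)⌋₊ :=
    Nat.floor_pos.2 (Real.one_le_rpow one_le_two (by nlinarith))
  set M := ⌊(2 : ℝ) ^ ((n : ℝ) * R)⌋₊ with hMdef
  set t : ℝ := 2 ^ ((n : ℝ) * (I + δ)) with ht
  obtain ⟨G, hG⟩ : ∃ G : (Fin n → X) → (Fin n → Y) → Prop, ∀ a b, G a b ↔
      ∏ i, W (a i) (b i) ≤ t * ∏ i, ∑ x, P x * W x (b i) ∧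
        ∀ k, |blockDist (d k) a b - D k| < ε / 2 := ⟨_, fun _ _ => Iff.rfl⟩
  have hr1 : ∑ y, ∑ x, P x * W x y = 1 := by rw [Finset.sum_comm]; exact hq1
  have hPn0 : ∀ a : Fin n → X, 0 ≤ ∏ i, P (a i) := fun a => Finset.prod_nonneg fun i _ => hP0 _
  have hPn := sum_block_iid (n := n) hP
  obtain ⟨C, hC⟩ := exists_codebook (P := fun a : Fin n → X => ∏ i, P (a i)) hPn0 hPn
    (Q := fun b : Fin n → Y => ∏ i, ∑ x, P x * W x (b i))
    (fun b => Finset.prod_nonneg fun i _ => Finset.sum_nonneg fun x _ => hq0 x _)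
    (sum_block_iid hr1)
    (K := fun a b => ∏ i, W (a i) (b i))
    (fun a b => Finset.prod_nonneg fun i _ => (hW _).1 _)
    (fun a => by simp [sum_block_prod (fun i => W (a i)), (hW _).2])
    G (t := t) (by positivity) (fun a b h => ((hG a b).1 h).1) M
  -- union bound over the ways in which a pair of blocks can be atypical
  have hTn : ∑ a : Fin n → X, ∑ b : Fin n → Y,
      (∏ i, P (a i)) * (∏ i, W (a i) (b i)) * (if G a b then 0 else 1) ≤ T n := by
    rw [← sum_block_pair (fun a b =>
      (∏ i, P (a i)) * (∏ i, W (a i) (b i)) * (if G a b then (0 : ℝ) else 1)), hT]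
    simp only
    rw [Finset.sum_comm, ← Finset.sum_add_distrib]
    refine Finset.sum_le_sum fun z _ => ?_
    rw [← Finset.mul_sum, ← mul_add, ← Finset.prod_mul_distrib]
    rcases (Finset.prod_nonneg fun i _ => hq0 (z i).1 (z i).2 :
      0 ≤ ∏ i, P (z i).1 * W (z i).1 (z i).2).eq_or_lt with h0 | hpos
    · simp [hq, ← h0]
    refine mul_le_mul_of_nonneg_left ?_ hpos.le
    have hs0 : ∀ k ∈ Finset.univ, (0 : ℝ) ≤
        if ε / 2 ≤ |1 / (n : ℝ) * ∑ i, d k (z i).1 (z i).2 - D k| then 1 else 0 :=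
      fun k _ => by split_ifs <;> norm_num
    have hs := Finset.sum_nonneg hs0
    by_cases h1 : δ ≤ |1 / (n : ℝ) * ∑ i, ι (z i) - I|
    · rw [if_pos h1]
      refine le_trans (b := 1) (by split_ifs <;> norm_num) (by linarith)
    rw [if_neg h1]
    split_ifs with h2
    · linarith
    · have hdom : ∏ i, W (z i).1 (z i).2 ≤ t * ∏ i, ∑ x, P x * W x (z i).2 := by
        refine prod_channel_le hP0 hW hn z (fun i => (hq0 _ _).lt_of_ne fun h => hpos.ne' ?_) ?_
        · exact Finset.prod_eq_zero (Finset.mem_univ i) h.symm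
        · have := (abs_lt.1 (not_le.1 h1)).2
          exact (sub_lt_iff_lt_add'.1 this).le
      obtain ⟨k, hk⟩ : ∃ k, ε / 2 ≤ |1 / (n : ℝ) * ∑ i, d k (z i).1 (z i).2 - D k| := by
        by_contra! hcon
        exact h2 ((hG _ _).2 ⟨hdom, hcon⟩)
      rw [zero_add]
      refine le_trans (le_of_eq ?_) (Finset.single_le_sum hs0 (Finset.mem_univ k))
      rw [if_pos hk]
  refine ⟨fun a => if h : ∃ m, G a (C m) then h.choose else ⟨0, hMpos⟩, C, fun k => ?_⟩
  set enc : (Fin n → X) → Fin M := fun a => if h : ∃ m, G a (C m) then h.choose else ⟨0, hMpos⟩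
    with henc
  have hterm : ∀ a, |blockDist (d k) a (C (enc a)) - D k| ≤
      ε / 2 + Bd * (if ∃ m, G a (C m) then 0 else 1) := by
    intro a
    by_cases h : ∃ m, G a (C m)
    · have : enc a = h.choose := by simp only [henc, dif_pos h]
      rw [if_pos h, this, mul_zero, add_zero]
      exact (((hG _ _).1 h.choose_spec).2 k).le
    · rw [if_neg h, mul_one]
      have h1 := abs_blockDist_le (d k) a (C (enc a))
      have h2 : ∑ x, ∑ y, |d k x y| + |D k| ≤ Bd :=
        Finset.single_le_sum (f := fun k => ∑ x, ∑ y, |d k x y| + |D k|)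
          (fun k _ => by positivity) (Finset.mem_univ k)
      have h3 := abs_sub (blockDist (d k) a (C (enc a))) (D k)
      linarith
  have e : ∑ x : Fin n → X, (∏ i, P (x i)) * blockDist (d k) x (C (enc x)) - D k =
      ∑ x : Fin n → X, (∏ i, P (x i)) * (blockDist (d k) x (C (enc x)) - D k) := by
    simp only [mul_sub, Finset.sum_sub_distrib, ← Finset.sum_mul, hPn, one_mul]
  rw [e]
  calc _ ≤ ∑ x : Fin n → X, |(∏ i, P (x i)) * (blockDist (d k) x (C (enc x)) - D k)| :=
        Finset.abs_sum_le_sum_abs _ _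
    _ ≤ ∑ x : Fin n → X, (∏ i, P (x i)) * (ε / 2 + Bd * (if ∃ m, G x (C m) then 0 else 1)) := by
        refine Finset.sum_le_sum fun x _ => ?_
        rw [abs_mul, abs_of_nonneg (hPn0 x)]
        exact mul_le_mul_of_nonneg_left (hterm x) (hPn0 x)
    _ = ε / 2 + Bd * ∑ x : Fin n → X, (∏ i, P (x i)) * (if ∃ m, G x (C m) then 0 else 1) := by
        simp only [mul_add, Finset.sum_add_distrib, ← Finset.sum_mul, hPn, one_mul,
          Finset.mul_sum]
        congr 1
        exact Finset.sum_congr rfl fun x _ => by ring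
    _ ≤ ε / 2 + Bd * (T n + Real.exp (-(M * t⁻¹))) := by
        gcongr
        exact hC.trans (add_le_add hTn le_rfl)
    _ ≤ ε := by linarith

end Achievability

/-! ### The converse -/

section Converse

variable {X Y : Type*} [Fintype X]

open Classical in
/-- The joint law of `(X_i, Y_i)` for a uniformly random time `i`, where `X_1, …, X_n` are i.i.d.
with law `P` and `Y` is the function `g` of the source block. -/
noncomputable def timeAvgLaw (P : X → ℝ) {n : ℕ} (g : (Fin n → X) → Fin n → Y)
    (x : X) (y : Y) : ℝ :=
  1 / (n : ℝ) * ∑ i, ∑ a : Fin n → X, (∏ j, P (a j)) * (if a i = x ∧ g a i = y then 1 else 0)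

variable {P : X → ℝ} {n : ℕ}

theorem timeAvgLaw_nonneg (hP0 : ∀ x, 0 ≤ P x) (g : (Fin n → X) → Fin n → Y) (x : X) (y : Y) :
    0 ≤ timeAvgLaw P g x y :=
  mul_nonneg (by positivity) (Finset.sum_nonneg fun i _ => Finset.sum_nonneg fun a _ =>
    mul_nonneg (Finset.prod_nonneg fun _ _ => hP0 _) (by split_ifs <;> norm_num))

/-- Expectations under the time-averaged law are time averages of expectations. -/
theorem sum_timeAvgLaw_mul [Fintype Y] (g : (Fin n → X) → Fin n → Y) (h : X → Y → ℝ) :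
    ∑ x, ∑ y, timeAvgLaw P g x y * h x y =
      ∑ a : Fin n → X, (∏ j, P (a j)) * blockDist h a (g a) := by
  classical
  have e : ∀ (a : Fin n → X) (i : Fin n),
      h (a i) (g a i) = ∑ x, ∑ y, (if a i = x ∧ g a i = y then 1 else 0) * h x y := by
    intro a i
    simp [ite_and]
  simp only [blockDist, e, timeAvgLaw, Finset.mul_sum, Finset.sum_mul]
  rw [Finset.sum_congr rfl fun x _ => Finset.sum_comm, Finset.sum_comm,
    Finset.sum_comm (s := (Finset.univ : Finset (Fin n → X)))]
  refine Finset.sum_congr rfl fun i _ => ?_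
  rw [Finset.sum_congr rfl fun x _ => Finset.sum_comm, Finset.sum_comm]
  refine Finset.sum_congr rfl fun a _ => Finset.sum_congr rfl fun x _ =>
    Finset.sum_congr rfl fun y _ => ?_
  split_ifs <;> ring

theorem sum_timeAvgLaw_right [Fintype Y] (hP : ∑ x, P x = 1) (hn : 0 < n)
    (g : (Fin n → X) → Fin n → Y) (x : X) : ∑ y, timeAvgLaw P g x y = P x := by
  classical
  have hn' : (n : ℝ) ≠ 0 := by exact_mod_cast hn.ne'
  have h1 := sum_timeAvgLaw_mul (P := P) g (fun x' _ => if x' = x then 1 else 0)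
  have h2 : ∑ x', ∑ y, timeAvgLaw P g x' y * (if x' = x then 1 else 0) =
      ∑ y, timeAvgLaw P g x y := by
    simp
  rw [← h2, h1]
  simp only [blockDist, Finset.mul_sum]
  rw [Finset.sum_comm]
  have h3 : ∀ i : Fin n, ∑ a : Fin n → X,
      (∏ j, P (a j)) * (1 / (n : ℝ) * if a i = x then 1 else 0) = 1 / n * P x := by
    intro i
    rw [sum_block_iid_mul hP i (fun x' => 1 / (n : ℝ) * if x' = x then 1 else 0)]
    simp [mul_comm]
  simp only [h3]
  simp
  field_simp

/-- On the support of the source, the time-averaged law charges every pair that occurs. -/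
theorem timeAvgLaw_pos (hP0 : ∀ x, 0 ≤ P x) (g : (Fin n → X) → Fin n → Y)
    {a : Fin n → X} (ha : 0 < ∏ j, P (a j)) (i : Fin n) :
    0 < timeAvgLaw P g (a i) (g a i) := by
  classical
  have hn : (0 : ℝ) < n := by exact_mod_cast i.pos
  refine mul_pos (by positivity) ?_
  have h0 : ∀ i' (a' : Fin n → X), 0 ≤ (∏ j, P (a' j)) *
      (if a' i' = a i ∧ g a' i' = g a i then (1 : ℝ) else 0) := fun i' a' =>
    mul_nonneg (Finset.prod_nonneg fun _ _ => hP0 _) (by split_ifs <;> norm_num)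
  refine lt_of_lt_of_le ?_ (Finset.single_le_sum
    (fun i' _ => Finset.sum_nonneg fun a' _ => h0 i' a') (Finset.mem_univ i))
  refine lt_of_lt_of_le ?_ (Finset.single_le_sum (fun a' _ => h0 i a') (Finset.mem_univ a))
  simpa using ha

/-- A code with `M` messages has single-letter information at most `(log M) / n`. With `V` the
backward channel of the time-averaged law, `n I = 𝔼 log Z` for `Z = ∏ V(X_i | Y_i) / P(X_i)`.
Each message contributes at most `1` to `𝔼 Z`, so `𝔼 Z ≤ M`, and Jensen's inequality (in the form
`log z ≤ z / M + log M - 1`) concludes. -/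
theorem mutualInfo_timeAvgLaw_le [Fintype Y] (hP0 : ∀ x, 0 ≤ P x) (hP : ∑ x, P x = 1) (hn : 0 < n)
    {M : ℕ} (enc : (Fin n → X) → Fin M) (dec : Fin M → Fin n → Y) :
    mutualInfo (timeAvgLaw P fun a => dec (enc a)) ≤ 1 / (n : ℝ) * Real.logb 2 M := by
  classical
  set g : (Fin n → X) → Fin n → Y := fun a => dec (enc a) with hg
  set q := timeAvgLaw P g with hq
  have hn' : (0 : ℝ) < n := by exact_mod_cast hn
  have hl2 : 0 < Real.log 2 := Real.log_pos one_lt_two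
  have hq0 : ∀ x y, 0 ≤ q x y := timeAvgLaw_nonneg hP0 g
  have hr0 : ∀ y, 0 ≤ ∑ x, q x y := fun y => Finset.sum_nonneg fun x _ => hq0 x y
  have hPn0 : ∀ a : Fin n → X, 0 ≤ ∏ i, P (a i) := fun a => Finset.prod_nonneg fun i _ => hP0 _
  have hPn := sum_block_iid (n := n) hP
  set V : Y → X → ℝ := fun y x => q x y / ∑ x', q x' y with hV
  have hV0 : ∀ y x, 0 ≤ V y x := fun y x => div_nonneg (hq0 x y) (hr0 y)
  have hV1 : ∀ y, ∑ x, V y x ≤ 1 := fun y => by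
    rw [← Finset.sum_div]; exact div_self_le_one _
  -- the messages are used by some block since the source has total mass one
  have hM : (0 : ℝ) < M := by
    obtain ⟨a, -, -⟩ : ∃ a ∈ (Finset.univ : Finset (Fin n → X)), 0 < ∏ i, P (a i) :=
      Finset.exists_lt_of_sum_lt (f := fun _ => 0) (by simp [hPn])
    exact_mod_cast (enc a).pos
  have hterm : ∀ a : Fin n → X,
      (∏ i, P (a i)) * ∑ i, Real.log (q (a i) (g a i) /
        ((∑ y, q (a i) y) * ∑ x, q x (g a i))) ≤
      (∏ i, V (g a i) (a i)) / M + (∏ i, P (a i)) * (Real.log M - 1) := by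
    intro a
    rcases (hPn0 a).eq_or_lt with h | h
    · rw [← h, zero_mul, zero_mul, add_zero]
      exact div_nonneg (Finset.prod_nonneg fun i _ => hV0 _ _) hM.le
    · have hqi : ∀ i, 0 < q (a i) (g a i) := fun i => timeAvgLaw_pos hP0 g h i
      have hPi : ∀ i, P (a i) ≠ 0 := fun i h0 =>
        h.ne' (Finset.prod_eq_zero (Finset.mem_univ i) h0)
      have hri : ∀ i, 0 < ∑ x, q x (g a i) := fun i =>
        (hqi i).trans_le (Finset.single_le_sum (f := fun x => q x (g a i))
          (fun x _ => hq0 x _) (Finset.mem_univ _))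
      have e : ∀ i, q (a i) (g a i) / ((∑ y, q (a i) y) * ∑ x, q x (g a i)) =
          V (g a i) (a i) / P (a i) := fun i => by
        rw [hq, sum_timeAvgLaw_right hP hn]
        simp only [hV]
        rw [div_div, mul_comm]
      have hVi : ∀ i, 0 < V (g a i) (a i) := fun i => div_pos (hqi i) (hri i)
      simp only [e]
      rw [← Real.log_prod fun i _ => div_ne_zero (hVi i).ne' (hPi i), Finset.prod_div_distrib]
      set v := ∏ i, V (g a i) (a i) with hv
      have hv0 : 0 < v := Finset.prod_pos fun i _ => hVi i
      have hlog := Real.log_le_sub_one_of_pos (div_pos (div_pos hv0 h) hM)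
      rw [Real.log_div (div_pos hv0 h).ne' hM.ne'] at hlog
      have := mul_le_mul_of_nonneg_left (sub_le_iff_le_add.1 hlog) h.le
      refine this.trans (le_of_eq ?_)
      field_simp
      ring
  have hsumV : ∑ a : Fin n → X, ∏ i, V (g a i) (a i) ≤ M := by
    calc ∑ a : Fin n → X, ∏ i, V (g a i) (a i)
        ≤ ∑ a : Fin n → X, ∑ m, ∏ i, V (dec m i) (a i) :=
          Finset.sum_le_sum fun a _ =>
            Finset.single_le_sum (f := fun m => ∏ i, V (dec m i) (a i))
              (fun m _ => Finset.prod_nonneg fun i _ => hV0 _ _) (Finset.mem_univ (enc a))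
      _ = ∑ m, ∏ i, ∑ x, V (dec m i) x := by
          rw [Finset.sum_comm]
          exact Finset.sum_congr rfl fun m _ => sum_block_prod fun i => V (dec m i)
      _ ≤ ∑ _m : Fin M, 1 := Finset.sum_le_sum fun m _ =>
          Finset.prod_le_one (fun i _ => Finset.sum_nonneg fun x _ => hV0 _ _) fun i _ => hV1 _
      _ = M := by simp
  have hI : mutualInfo q = 1 / (n : ℝ) * ((∑ a : Fin n → X, (∏ i, P (a i)) *
      ∑ i, Real.log (q (a i) (g a i) / ((∑ y, q (a i) y) * ∑ x, q x (g a i)))) /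
        Real.log 2) := by
    rw [mutualInfo, hq, sum_timeAvgLaw_mul g, Finset.sum_div, Finset.mul_sum]
    refine Finset.sum_congr rfl fun a _ => ?_
    simp only [blockDist, Real.logb, ← Finset.sum_div]
    ring
  rw [hI, Real.logb]
  gcongr
  refine (Finset.sum_le_sum fun a _ => hterm a).trans ?_
  rw [Finset.sum_add_distrib, ← Finset.sum_div, ← Finset.sum_mul, hPn, one_mul]
  have := (div_le_one hM).2 hsumV
  linarith

end Converse

/-! ### Reduction of the state distortion to the surrogate distortion -/

section Surrogate

variable {S X Sh Xh : Type*} [Fintype S]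

theorem margX_nonneg {p : S × X → ℝ} (hp : ∀ z, 0 ≤ p z) (x : X) : 0 ≤ margX p x :=
  Finset.sum_nonneg fun _ _ => hp _

theorem sum_margX [Fintype X] {p : S × X → ℝ} (hp : ∑ z, p z = 1) : ∑ x, margX p x = 1 := by
  simp only [margX]
  rw [Finset.sum_comm, ← Fintype.sum_prod_type', ← hp]

theorem margX_mul_dHat {p : S × X → ℝ} (hp : ∀ z, 0 ≤ p z) (ds : S → Sh → ℝ) (x : X) (sh : Sh) :
    margX p x * dHat p ds x sh = ∑ s, p (s, x) * ds s sh := by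
  by_cases h : margX p x = 0
  · have h0 := (Finset.sum_eq_zero_iff_of_nonneg fun s _ => hp (s, x)).1 h
    rw [h, zero_mul]
    exact (Finset.sum_eq_zero fun s hs => by rw [h0 s hs, zero_mul]).symm
  · rw [dHat]
    field_simp

theorem jointLaw_nonneg {Y : Type*} [Fintype Y] {p : S × X → ℝ} (hp : ∀ z, 0 ≤ p z)
    {W : X → Y → ℝ} (hW : ∀ x, W x ∈ stdSimplex ℝ Y) (x : X) (y : Y) : 0 ≤ jointLaw p W x y :=
  mul_nonneg (margX_nonneg hp x) ((hW x).1 y)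

/-- Averaging over the states given the observations turns `ds` into the surrogate. -/
theorem Code.expDistS_eq [Fintype X] {p : S × X → ℝ} (hp : ∀ z, 0 ≤ p z) (ds : S → Sh → ℝ)
    {n M : ℕ} (c : Code X Sh Xh n M) :
    c.expDistS p ds = ∑ x : Fin n → X, (∏ i, margX p (x i)) *
      blockDist (dHat p ds) x (c.dec (c.enc x)).1 := by
  classical
  rw [Code.expDistS]
  have h := sum_block_pair (fun (s : Fin n → S) (x : Fin n → X) =>
    (∏ i, p (s i, x i)) * blockDist ds s (c.dec (c.enc x)).1)
  refine h.trans ?_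
  rw [Finset.sum_comm]
  refine Finset.sum_congr rfl fun x _ => ?_
  simp only [blockDist, Finset.mul_sum]
  rw [Finset.sum_comm]
  refine Finset.sum_congr rfl fun j _ => ?_
  have h1 := sum_block_prod_mul (fun i s => p (s, x i)) j
    (fun s => ds s ((c.dec (c.enc x)).1 j))
  rw [← margX_mul_dHat hp, ← mul_assoc] at h1
  have h2 := Finset.prod_erase_mul Finset.univ (fun i => margX p (x i)) (Finset.mem_univ j)
  simp only [margX] at h1 h2 ⊢
  rw [h2] at h1
  rw [mul_left_comm, ← h1, Finset.mul_sum]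
  exact Finset.sum_congr rfl fun s _ => by ring

theorem Code.expDistA_eq [Fintype X] {p : S × X → ℝ} (da : X → Xh → ℝ) {n M : ℕ}
    (c : Code X Sh Xh n M) :
    c.expDistA p da = ∑ x : Fin n → X, (∏ i, margX p (x i)) *
      blockDist da x (c.dec (c.enc x)).2 := by
  classical
  rw [Code.expDistA]
  have h := sum_block_pair (fun (s : Fin n → S) (x : Fin n → X) =>
    (∏ i, p (s i, x i)) * blockDist da x (c.dec (c.enc x)).2)
  refine h.trans ?_
  rw [Finset.sum_comm]
  refine Finset.sum_congr rfl fun x _ => ?_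
  rw [← Finset.sum_mul, sum_block_prod (fun i s => p (s, x i))]
  rfl

end Surrogate

/-! ### The single-letter problem and the coding theorem -/

section Main

variable {S X Sh Xh : Type*} [Fintype S] [Fintype X] [Fintype Sh] [Fintype Xh]

theorem continuousOn_mutualInfo_jointLaw {Y : Type*} [Fintype Y] {p : S × X → ℝ}
    (hp : ∀ z, 0 ≤ p z) :
    ContinuousOn (fun W : X → Y → ℝ => mutualInfo (jointLaw p W))
      {W | ∀ x, W x ∈ stdSimplex ℝ Y} := by
  have h : Continuous fun W : X → Y → ℝ =>
      (∑ x, ∑ y, jointLaw p W x y * Real.log (jointLaw p W x y) -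
        ∑ x, (∑ y, jointLaw p W x y) * Real.log (∑ y, jointLaw p W x y) -
        ∑ y, (∑ x, jointLaw p W x y) * Real.log (∑ x, jointLaw p W x y)) / Real.log 2 := by
    have hc : ∀ x y, Continuous fun W : X → Y → ℝ => jointLaw p W x y := fun x y => by
      unfold jointLaw; fun_prop
    refine ((Continuous.sub (Continuous.sub ?_ ?_) ?_)).div_const _
    · exact continuous_finsetSum _ fun x _ => continuous_finsetSum _ fun y _ =>
        Real.continuous_mul_log.comp (hc x y)
    · exact continuous_finsetSum _ fun x _ =>
        Real.continuous_mul_log.comp (continuous_finsetSum _ fun y _ => hc x y)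
    · exact continuous_finsetSum _ fun y _ =>
        Real.continuous_mul_log.comp (continuous_finsetSum _ fun x _ => hc x y)
  exact h.continuousOn.congr fun W hW => mutualInfo_eq (jointLaw_nonneg hp hW)

theorem isCompact_channels (X Y : Type*) [Fintype Y] :
    IsCompact {W : X → Y → ℝ | ∀ x, W x ∈ stdSimplex ℝ Y} := by
  have := isCompact_univ_pi fun _ : X => isCompact_stdSimplex ℝ Y
  simpa [Set.pi] using this

theorem continuous_sum_jointLaw_mul {Y : Type*} [Fintype Y] (p : S × X → ℝ) (h : X → Y → ℝ) :
    Continuous fun W : X → Y → ℝ => ∑ x, ∑ y, jointLaw p W x y * h x y := by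
  unfold jointLaw; fun_prop

theorem isCompact_feasible (p : S × X → ℝ) (ds : S → Sh → ℝ) (da : X → Xh → ℝ) (Ds Da : ℝ) :
    IsCompact (feasible p ds da Ds Da) := by
  refine (isCompact_channels X (Sh × Xh)).inter_right (IsClosed.inter ?_ ?_)
  · exact isClosed_le (continuous_sum_jointLaw_mul p fun x (y : Sh × Xh) => dHat p ds x y.1)
      continuous_const
  · exact isClosed_le (continuous_sum_jointLaw_mul p fun x (y : Sh × Xh) => da x y.2)
      continuous_const

/-- Single-letterization: the channel of the time-averaged law has the distortions of the code,
and information at most the rate. -/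
theorem Code.exists_channel {p : S × X → ℝ} (hp : p ∈ stdSimplex ℝ (S × X)) (ds : S → Sh → ℝ)
    (da : X → Xh → ℝ) {n M : ℕ} (hn : 0 < n) (c : Code X Sh Xh n M) :
    ∃ W : X → Sh × Xh → ℝ, (∀ x, W x ∈ stdSimplex ℝ (Sh × Xh)) ∧
      ∑ x, ∑ y, jointLaw p W x y * dHat p ds x y.1 = c.expDistS p ds ∧
      ∑ x, ∑ y, jointLaw p W x y * da x y.2 = c.expDistA p da ∧
      mutualInfo (jointLaw p W) ≤ 1 / (n : ℝ) * Real.logb 2 M := by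
  classical
  have hP0 := margX_nonneg hp.1
  have hP := sum_margX hp.2
  set dec : Fin M → Fin n → Sh × Xh := fun m i => ((c.dec m).1 i, (c.dec m).2 i) with hdec
  set q := timeAvgLaw (margX p) fun a => dec (c.enc a) with hq
  have hq0 : ∀ x y, 0 ≤ q x y := timeAvgLaw_nonneg hP0 _
  have hq1 : ∀ x, ∑ y, q x y = margX p x := sum_timeAvgLaw_right hP hn _
  obtain ⟨x₀, -, -⟩ : ∃ x ∈ (Finset.univ : Finset X), 0 < margX p x :=
    Finset.exists_lt_of_sum_lt (f := fun _ => 0) (by simp [hP])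
  -- any letter serves as the output for observations of probability zero
  let y₀ : Sh × Xh := dec (c.enc fun _ => x₀) ⟨0, hn⟩
  set W : X → Sh × Xh → ℝ := fun x =>
    if margX p x = 0 then Pi.single y₀ 1 else fun y => q x y / margX p x with hW
  have hWq : jointLaw p W = q := by
    funext x y
    simp only [jointLaw, hW]
    split_ifs with h
    · have := (Finset.sum_eq_zero_iff_of_nonneg fun y _ => hq0 x y).1 ((hq1 x).trans h) y
        (Finset.mem_univ y)
      rw [h, zero_mul, this]
    · field_simp
  refine ⟨W, fun x => ?_, ?_, ?_, ?_⟩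
  · simp only [hW]
    split_ifs with h
    · exact single_mem_stdSimplex ℝ y₀
    · exact ⟨fun y => div_nonneg (hq0 x y) (hP0 x), by rw [← Finset.sum_div, hq1, div_self h]⟩
  · rw [hWq, hq, sum_timeAvgLaw_mul _ (fun x (y : Sh × Xh) => dHat p ds x y.1),
      Code.expDistS_eq hp.1]
    rfl
  · rw [hWq, hq, sum_timeAvgLaw_mul _ (fun x (y : Sh × Xh) => da x y.2), Code.expDistA_eq]
    rfl
  · rw [hWq]
    exact mutualInfo_timeAvgLaw_le hP0 hP hn c.enc dec

theorem exists_feasible_of_achievable {p : S × X → ℝ} (hp : p ∈ stdSimplex ℝ (S × X))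
    {ds : S → Sh → ℝ} {da : X → Xh → ℝ} {R Ds Da : ℝ} (h : Achievable p ds da R Ds Da) :
    ∃ W ∈ feasible p ds da Ds Da, mutualInfo (jointLaw p W) ≤ R := by
  obtain ⟨c, ⟨Ls, hLs, hts⟩, ⟨La, hLa, hta⟩⟩ := h
  choose W hW hWs hWa hWI using fun n : ℕ => (c (n + 1)).exists_channel hp ds da n.succ_pos
  obtain ⟨V, hV, φ, hφ, hlim⟩ := (isCompact_channels X (Sh × Xh)).tendsto_subseq hW
  have hφ1 : Tendsto (fun k => φ k + 1) atTop atTop :=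
    (tendsto_add_atTop_nat 1).comp hφ.tendsto_atTop
  refine ⟨V, ⟨hV, ?_, ?_⟩, ?_⟩
  · have h1 := ((continuous_sum_jointLaw_mul p
      fun x (y : Sh × Xh) => dHat p ds x y.1).tendsto V).comp hlim
    have h2 := hts.comp hφ1
    refine (tendsto_nhds_unique h1 (h2.congr fun k => (hWs (φ k)).symm)).trans_le hLs
  · have h1 := ((continuous_sum_jointLaw_mul p
      fun x (y : Sh × Xh) => da x y.2).tendsto V).comp hlim
    have h2 := hta.comp hφ1
    refine (tendsto_nhds_unique h1 (h2.congr fun k => (hWa (φ k)).symm)).trans_le hLa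
  · have h1 := (continuousOn_mutualInfo_jointLaw hp.1 V hV).tendsto.comp
      (tendsto_nhdsWithin_iff.2 ⟨hlim, Eventually.of_forall fun k => hW (φ k)⟩)
    refine le_of_tendsto h1 (Eventually.of_forall fun k => (hWI (φ k)).trans ?_)
    have hn : (0 : ℝ) < ((φ k + 1 : ℕ) : ℝ) := by positivity
    rw [one_div, inv_mul_le_iff₀ hn]
    -- the encoder outputs a message, so `⌊2 ^ (n R)⌋` is not zero
    obtain ⟨⟨_, x⟩, -, -⟩ : ∃ z ∈ (Finset.univ : Finset (S × X)), 0 < p z :=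
      Finset.exists_lt_of_sum_lt (f := fun _ => 0) (by simp [hp.2])
    have hpos := ((c (φ k + 1)).enc fun _ => x).pos
    rw [Real.logb_le_iff_le_rpow one_lt_two (by exact_mod_cast hpos)]
    exact Nat.floor_le (by positivity)

instance Code.instFinite {n M : ℕ} : Finite (Code X Sh Xh n M) :=
  Finite.of_injective (fun c => (c.enc, c.dec)) fun c c' h => by
    cases c; cases c'; simpa using h

/-- Good block codes approach the distortions of the channel `W` from both sides, so the
distortions of the best ones converge to those of `W`. -/
theorem achievable_of_mutualInfo_lt {p : S × X → ℝ} (hp : p ∈ stdSimplex ℝ (S × X))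
    {ds : S → Sh → ℝ} {da : X → Xh → ℝ} {Ds Da : ℝ} {W : X → Sh × Xh → ℝ}
    (hW : W ∈ feasible p ds da Ds Da) {R : ℝ} (hR : mutualInfo (jointLaw p W) < R) :
    Achievable p ds da R Ds Da := by
  obtain ⟨hW1, hWs, hWa⟩ := hW
  set Ls := ∑ x, ∑ y, jointLaw p W x y * dHat p ds x y.1 with hLs
  set La := ∑ x, ∑ y, jointLaw p W x y * da x y.2 with hLa
  have hP0 := margX_nonneg hp.1
  have hP := sum_margX hp.2
  have hI0 : 0 ≤ mutualInfo (jointLaw p W) :=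
    mutualInfo_nonneg (jointLaw_nonneg hp.1 hW1) (by
      simp [jointLaw, ← Finset.mul_sum, (hW1 _).2, hP])
  have hex : ∀ ε > 0, ∀ᶠ n : ℕ in atTop, ∃ c : Code X Sh Xh n ⌊(2 : ℝ) ^ ((n : ℝ) * R)⌋₊,
      |c.expDistS p ds - Ls| ≤ ε ∧ |c.expDistA p da - La| ≤ ε := by
    intro ε hε
    filter_upwards [eventually_exists_block_code hP0 hP hW1
      (fun (k : Bool) x (y : Sh × Xh) => if k then dHat p ds x y.1 else da x y.2) hR hε]
      with n ⟨enc, dec, h⟩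
    refine ⟨⟨enc, fun m => (fun i => (dec m i).1, fun i => (dec m i).2)⟩, ?_, ?_⟩
    · rw [Code.expDistS_eq hp.1]
      simpa [blockDist, jointLaw, hLs] using h true
    · rw [Code.expDistA_eq]
      simpa [blockDist, jointLaw, hLa] using h false
  -- at each length, take a code whose distortions deviate least from `Ls` and `La`
  have hne : ∀ n : ℕ, Nonempty (Code X Sh Xh n ⌊(2 : ℝ) ^ ((n : ℝ) * R)⌋₊) := by
    intro n
    obtain ⟨x₀, -, -⟩ : ∃ x ∈ (Finset.univ : Finset X), 0 < margX p x :=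
      Finset.exists_lt_of_sum_lt (f := fun _ => 0) (by simp [hP])
    obtain ⟨y₀, -, -⟩ : ∃ y ∈ (Finset.univ : Finset (Sh × Xh)), 0 < W x₀ y :=
      Finset.exists_lt_of_sum_lt (f := fun _ => 0) (by simp [(hW1 x₀).2])
    have hM : 0 < ⌊(2 : ℝ) ^ ((n : ℝ) * R)⌋₊ := Nat.floor_pos.2
      (Real.one_le_rpow one_le_two (mul_nonneg n.cast_nonneg (hI0.trans hR.le)))
    exact ⟨⟨fun _ => ⟨0, hM⟩, fun _ => (fun _ => y₀.1, fun _ => y₀.2)⟩⟩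
  choose c hc using fun n : ℕ => Finite.exists_min
    fun c : Code X Sh Xh n ⌊(2 : ℝ) ^ ((n : ℝ) * R)⌋₊ =>
      max |c.expDistS p ds - Ls| |c.expDistA p da - La|
  have hsmall : ∀ ε > 0, ∀ᶠ n : ℕ in atTop,
      max |(c n).expDistS p ds - Ls| |(c n).expDistA p da - La| ≤ ε := by
    intro ε hε
    filter_upwards [hex ε hε] with n ⟨c', h1, h2⟩
    exact (hc n c').trans (max_le h1 h2)
  refine ⟨c, ⟨Ls, hWs, ?_⟩, ⟨La, hWa, ?_⟩⟩
  · refine Metric.tendsto_nhds.2 fun ε hε => ?_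
    filter_upwards [hsmall (ε / 2) (half_pos hε)] with n h
    exact ((le_max_left _ _).trans h).trans_lt (half_lt_self hε)
  · refine Metric.tendsto_nhds.2 fun ε hε => ?_
    filter_upwards [hsmall (ε / 2) (half_pos hε)] with n h
    exact ((le_max_right _ _).trans h).trans_lt (half_lt_self hε)

end Main

end SORDF

theorem theorem1 {S X Sh Xh : Type*} [Fintype S] [Fintype X] [Fintype Sh] [Fintype Xh]
    (p : S × X → ℝ) (hp : p ∈ stdSimplex ℝ (S × X))
    (ds : S → Sh → ℝ) (hds : ∀ s sh, 0 ≤ ds s sh)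
    (da : X → Xh → ℝ) (hda : ∀ x xh, 0 ≤ da x xh)
    (Ds Da : ℝ) :
    -- the rate-distortion function is the value of the single-letter problem
    SORDF.sordf p ds da Ds Da =
        ⨅ W ∈ SORDF.feasible p ds da Ds Da,
          ((SORDF.mutualInfo (SORDF.jointLaw p W) : ℝ) : EReal) ∧
    -- the infimum is a minimum whenever the constraints can be met
    ((SORDF.feasible p ds da Ds Da).Nonempty →
      ∃ W ∈ SORDF.feasible p ds da Ds Da,
        IsMinOn (fun V => SORDF.mutualInfo (SORDF.jointLaw p V))
          (SORDF.feasible p ds da Ds Da) W) ∧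
    -- achievability
    (∀ W ∈ SORDF.feasible p ds da Ds Da, ∀ R : ℝ,
      SORDF.mutualInfo (SORDF.jointLaw p W) < R → SORDF.Achievable p ds da R Ds Da) ∧
    -- converse
    (∀ R : ℝ, SORDF.Achievable p ds da R Ds Da →
      ∃ W ∈ SORDF.feasible p ds da Ds Da, SORDF.mutualInfo (SORDF.jointLaw p W) ≤ R) := by
  have hach : ∀ W ∈ SORDF.feasible p ds da Ds Da, ∀ R : ℝ,
      SORDF.mutualInfo (SORDF.jointLaw p W) < R → SORDF.Achievable p ds da R Ds Da :=
    fun W hW R hR => SORDF.achievable_of_mutualInfo_lt hp hW hR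
  have hconv : ∀ R : ℝ, SORDF.Achievable p ds da R Ds Da →
      ∃ W ∈ SORDF.feasible p ds da Ds Da, SORDF.mutualInfo (SORDF.jointLaw p W) ≤ R :=
    fun R hR => SORDF.exists_feasible_of_achievable hp hR
  refine ⟨le_antisymm ?_ ?_, fun hne => ?_, hach, hconv⟩
  · refine le_iInf₂ fun W hW => EReal.le_of_forall_lt_iff_le.1 fun R hR => ?_
    exact iInf₂_le R (hach W hW R (EReal.coe_lt_coe_iff.1 hR))
  · refine le_iInf₂ fun R hR => ?_
    obtain ⟨W, hW, hWR⟩ := hconv R hR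
    exact (iInf₂_le W hW).trans (EReal.coe_le_coe_iff.2 hWR)
  · exact (SORDF.isCompact_feasible p ds da Ds Da).exists_isMinOn hne
      ((SORDF.continuousOn_mutualInfo_jointLaw hp.1).mono fun W hW => hW.1)
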